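/- Let $X$ be an $\mathbb{R}^d$-valued random variable, $f:\mathbb{R}^d\to\mathbb{R}$ a measurable function with $\mathbb{E}[f^2(X)]<\infty$, and $c=\mathbb{E}[f(X)]$. Let $(A_i)_{1\le i\le I}$ be a measurable partition of $\mathbb{R}^d$ into strata with $p_i=\mathbb{P}(X\in A_i)>0$ for all $i$, let $\sigma_i\ge 0$ be given by $\sigma_i^2=\mathrm{Var}(f(X)\mid X\in A_i)$, and assume that $\sigma_i>0$ for at least one $i$. Put $\sigma_*=\sum_{i=1}^I p_i\sigma_i$ and $q_i^*=p_i\sigma_i/\sum_{j=1}^I p_j\sigma_j$. Let $(X_i^j)_{1\le i\le I,\,j\ge 1}$ be independent random variables such that $X_i^j$ is distributed according to the conditional law of $X$ given $X\in A_i$. Let $(N^k)_{k\ge 0}$ be a deterministic sequence of integers with $N^0=0$ and $N^k-N^{k-1}\ge I$ for all $k\ge 1$, and let $N_i^k$ ($1\le i\le I$, $k\ge 0$) be integer-valued random variables, the number of drawings in stratum $i$ up to the end of step $k$, such that $N_i^0=0$, $N_i^k-N_i^{k-1}\ge 1$ for all $k\ge 1$, $\sum_{i=1}^I N_i^k=N^k$,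 and, for all $k\ge1$, the $N_i^k$ are measurable with respect to the information contained in the first $N^{k-1}$ drawings, that is, with respect to $\sigma(\mathbf{1}_{\{j\le N_l^{k-1}\}}X_l^j,\ 1\le l\le I,\ j\ge 1)$. For $k\ge 1$ let $$\hat c^k=\sum_{i=1}^I\frac{p_i}{N_i^k}\sum_{j=1}^{N_i^k}f(X_i^j).$$ If $N_i^k/N^k\to q_i^*$ almost surely as $k\to\infty$ for every $1\le i\le I$, then $$\sqrt{N^k}\,(\hat c^k-c)\xrightarrow[k\to\infty]{}\mathcal{N}(0,\sigma_*^2)\quad\text{in law}.$$ -/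

import Mathlib

open MeasureTheory ProbabilityTheory Filter
open scoped Topology

noncomputable section

namespace Stratified

variable {Ω₀ Ω : Type*} [MeasurableSpace Ω₀] {d I : ℕ}

/-- `p_i = P(X ∈ A_i)`. -/
def prob (P₀ : Measure Ω₀) (X : Ω₀ → EuclideanSpace ℝ (Fin d))
    (A : Fin I → Set (EuclideanSpace ℝ (Fin d))) (i : Fin I) : ℝ :=
  P₀.real (X ⁻¹' A i)

/-- The conditional law of `X` given `X ∈ A_i`. -/
def condLaw (P₀ : Measure Ω₀) (X : Ω₀ → EuclideanSpace ℝ (Fin d))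
    (A : Fin I → Set (EuclideanSpace ℝ (Fin d))) (i : Fin I) :
    Measure (EuclideanSpace ℝ (Fin d)) :=
  (cond P₀ (X ⁻¹' A i)).map X

/-- `σ_i`, the standard deviation of `f` under the conditional law of `X` given `X ∈ A_i`. -/
def sd (P₀ : Measure Ω₀) (X : Ω₀ → EuclideanSpace ℝ (Fin d))
    (A : Fin I → Set (EuclideanSpace ℝ (Fin d))) (f : EuclideanSpace ℝ (Fin d) → ℝ)
    (i : Fin I) : ℝ :=
  √(variance f (condLaw P₀ X A i))

/-- `σ_* = ∑ p_i σ_i`. -/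
def sdStar (P₀ : Measure Ω₀) (X : Ω₀ → EuclideanSpace ℝ (Fin d))
    (A : Fin I → Set (EuclideanSpace ℝ (Fin d))) (f : EuclideanSpace ℝ (Fin d) → ℝ) : ℝ :=
  ∑ i, prob P₀ X A i * sd P₀ X A f i

/-- The optimal proportion `q_i^* = p_i σ_i / ∑ p_j σ_j`. -/
def qStar (P₀ : Measure Ω₀) (X : Ω₀ → EuclideanSpace ℝ (Fin d))
    (A : Fin I → Set (EuclideanSpace ℝ (Fin d))) (f : EuclideanSpace ℝ (Fin d) → ℝ)
    (i : Fin I) : ℝ :=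
  prob P₀ X A i * sd P₀ X A f i / ∑ j, prob P₀ X A j * sd P₀ X A f j

/-- The information in the drawings made so far, when `n i` drawings have been made in stratum `i`:
the sigma-algebra generated by all the variables `1_{j ≤ n i} X_i^j`.
The drawings are numbered from `0`: `Xs i j` stands for `X_i^{j+1}`. -/
def drawInfo (Xs : Fin I → ℕ → Ω → EuclideanSpace ℝ (Fin d)) (n : Fin I → Ω → ℕ) :
    MeasurableSpace Ω :=
  ⨆ (i : Fin I) (j : ℕ),
    MeasurableSpace.comap (fun ω => if j < n i ω then Xs i j ω else 0) inferInstance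

/-- `N k` is the (deterministic) total number of drawings up to the end of step `k`, and
`Ns k i` the (random) number of those made in stratum `i`. At least one drawing is made in each
stratum at each step, and the allocation of step `k + 1` is computed from the information
contained in the drawings of the steps `1, …, k`. -/
structure IsAdaptiveAllocation (Xs : Fin I → ℕ → Ω → EuclideanSpace ℝ (Fin d))
    (N : ℕ → ℕ) (Ns : ℕ → Fin I → Ω → ℕ) : Prop where
  total_zero : N 0 = 0
  total_step : ∀ k, N k + I ≤ N (k + 1)
  zero : ∀ i ω, Ns 0 i ω = 0
  step : ∀ k i ω, Ns k i ω + 1 ≤ Ns (k + 1) i ω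
  sum_eq : ∀ k ω, ∑ i, Ns k i ω = N k
  nonanticipating : ∀ k i, Measurable[drawInfo Xs (Ns k)] (Ns (k + 1) i)

/-- The stratified estimator `∑ i, (p_i / n_i) ∑_{j ≤ n_i} f(X_i^j)` based on `n i` drawings
in stratum `i`. -/
def estimator (p : Fin I → ℝ) (f : EuclideanSpace ℝ (Fin d) → ℝ)
    (Xs : Fin I → ℕ → Ω → EuclideanSpace ℝ (Fin d)) (n : Fin I → Ω → ℕ) (ω : Ω) : ℝ :=
  ∑ i, p i / (n i ω : ℝ) * ∑ j ∈ Finset.range (n i ω), f (Xs i j ω)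

end Stratified

end

/-! Anscombe's argument. With `Y i j` the centred value of `f` at the drawing `X_i^j`, the error is,
for `k ≥ 1`, `∑ i, (p_i / N_i^k) ∑_{j < N_i^k} Y i j`, because the `p_i` average the conditional
means to `c`. If every `N_i^k` were the deterministic `⌊q_i^* N^k⌋`, the classical CLT and
independence of the strata would give a Gaussian limit of variance `∑ i, (p_i / q_i^*)² σ_i² q_i^* =
σ_*²`, the sum running over `σ_i > 0`. The random sizes may depend on the drawings, but they stay
near the deterministic ones. A maximal inequality bounds the partial sums over a whole window of
indices at once, so how the index is selected inside it does not matter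
(`tendstoInMeasure_sum_random_sub_sum_floor`). The CLT at deterministic sizes
(`tendstoInDistribution_sum_strata_floor`) then transfers by Slutsky in
`tendstoInDistribution_stratified`. -/

namespace Stratified

/-! ### Maximal inequality and sums with a random number of terms -/

section Sums

variable {Ω : Type*} [MeasurableSpace Ω] {P : Measure Ω} [IsProbabilityMeasure P]

/-- The partial sums of independent centered random variables form a martingale. -/
lemma martingale_sum_range {Y : ℕ → Ω → ℝ} (hY : ∀ j, StronglyMeasurable (Y j))
    (hint : ∀ j, Integrable (Y j) P) (hmean : ∀ j, P[Y j] = 0) (hindep : iIndepFun Y P) :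
    Martingale (fun n => ∑ j ∈ Finset.range (n + 1), Y j) (Filtration.natural Y hY) P := by
  refine martingale_of_condExp_sub_eq_zero_nat (fun n => ?_) (fun n => ?_) (fun n => ?_)
  · refine Finset.stronglyMeasurable_sum _ fun j hj => ?_
    exact ((Filtration.stronglyAdapted_natural hY) j).mono
      ((Filtration.natural Y hY).mono (Finset.mem_range_succ_iff.1 hj))
  · exact integrable_finsetSum' _ fun j _ => hint j
  · have h : (∑ j ∈ Finset.range (n + 1 + 1), Y j) - ∑ j ∈ Finset.range (n + 1), Y j
        = Y (n + 1) := by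
      rw [Finset.sum_range_succ]; abel
    rw [h]
    refine (hindep.condExp_natural_ae_eq_of_lt hY (Nat.lt_succ_self n)).trans ?_
    rw [hmean]; rfl

/-- The first absolute moment of a sum of independent centered random variables. -/
lemma integral_abs_sum_le {Y : ℕ → Ω → ℝ} {v : ℝ} (hL2 : ∀ j, MemLp (Y j) 2 P)
    (hmean : ∀ j, P[Y j] = 0) (hvar : ∀ j, Var[Y j; P] = v) (hindep : iIndepFun Y P) (n : ℕ) :
    ∫ ω, |∑ j ∈ Finset.range n, Y j ω| ∂P ≤ √(n * v) := by
  have hS : MemLp (∑ j ∈ Finset.range n, Y j) 2 P := memLp_finsetSum' _ fun j _ => hL2 j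
  have hvarS : Var[∑ j ∈ Finset.range n, Y j; P] = n * v := by
    rw [IndepFun.variance_sum (fun j _ => hL2 j) (fun i _ j _ hij => hindep.indepFun hij)]
    simp [hvar]
  have hmeanS : P[∑ j ∈ Finset.range n, Y j] = 0 := by
    simp only [Finset.sum_apply]
    rw [integral_finsetSum _ fun j _ => (hL2 j).integrable one_le_two]
    exact Finset.sum_eq_zero fun j _ => hmean j
  have habs : MemLp (fun ω => |(∑ j ∈ Finset.range n, Y j) ω|) 2 P := hS.abs
  -- `(E|S|)² ≤ E[S²]` is nonnegativity of the variance of `|S|`.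
  have h1 := variance_nonneg (fun ω => |(∑ j ∈ Finset.range n, Y j) ω|) P
  rw [variance_eq_sub habs] at h1
  rw [variance_eq_sub hS, hmeanS] at hvarS
  refine Real.le_sqrt_of_sq_le ?_
  simp only [Pi.pow_apply, sq_abs, Finset.sum_apply] at h1 hvarS
  linarith

/-- A weak form of Kolmogorov's maximal inequality. -/
lemma mul_measureReal_exists_le_abs_sum {Y : ℕ → Ω → ℝ} {v : ℝ} (hY : ∀ j, Measurable (Y j))
    (hL2 : ∀ j, MemLp (Y j) 2 P) (hmean : ∀ j, P[Y j] = 0) (hvar : ∀ j, Var[Y j; P] = v)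
    (hindep : iIndepFun Y P) (n : ℕ) {ε : ℝ} (hε : 0 < ε) :
    ε * P.real {ω | ∃ m ≤ n, ε ≤ |∑ j ∈ Finset.range m, Y j ω|} ≤ √(n * v) := by
  have hmart := martingale_sum_range (fun j => (hY j).stronglyMeasurable)
    (fun j => (hL2 j).integrable one_le_two) hmean hindep
  -- `|S| = S ⊔ -S` is a submartingale, so Doob's maximal inequality applies to it.
  have hsub := hmart.submartingale.sup hmart.neg.submartingale
  set g := (fun n => ∑ j ∈ Finset.range (n + 1), Y j) ⊔
    -(fun n => ∑ j ∈ Finset.range (n + 1), Y j) with hg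
  have hg_apply (k : ℕ) (ω : Ω) : g k ω = |∑ j ∈ Finset.range (k + 1), Y j ω| := by
    simp [hg, abs]
  -- The martingale at time `n` has `n + 1` terms, so the empty sum is treated apart.
  rcases n with _ | n
  · simp [hε.not_ge]
  have key := maximal_ineq hsub (fun k ω => by rw [hg_apply]; exact abs_nonneg _)
    (ε := ⟨ε, hε.le⟩) n
  set E := {ω | ((⟨ε, hε.le⟩ : NNReal) : ℝ) ≤
    (Finset.range (n + 1)).sup' Finset.nonempty_range_add_one fun k => g k ω} with hE
  have hsubset : {ω | ∃ m ≤ n + 1, ε ≤ |∑ j ∈ Finset.range m, Y j ω|} ⊆ E := by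
    rintro ω ⟨m, hm, h⟩
    rcases m with _ | m
    · simp at h; linarith
    · simp only [hE, Set.mem_ofPred_eq, Finset.le_sup'_iff]
      exact ⟨m, Finset.mem_range.2 (Nat.lt_of_succ_le hm), by rw [hg_apply]; exact h⟩
  have hset : ∫ ω in E, g n ω ∂P ≤ √((n + 1 : ℕ) * v) := by
    refine le_trans (setIntegral_le_integral (hsub.integrable n) (ae_of_all _ fun ω => ?_)) ?_
    · rw [hg_apply]; exact abs_nonneg _
    · simp_rw [hg_apply]
      exact integral_abs_sum_le hL2 hmean hvar hindep (n + 1)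
  have hreal : ε * P.real E ≤ √((n + 1 : ℕ) * v) := by
    have h2 := ENNReal.toReal_mono ENNReal.ofReal_ne_top key
    rw [ENNReal.toReal_mul, ENNReal.toReal_ofReal
      (setIntegral_nonneg_of_ae (ae_of_all _ fun ω => by rw [hg_apply]; exact abs_nonneg _))] at h2
    exact le_trans h2 hset
  exact le_trans (mul_le_mul_of_nonneg_left (measureReal_mono hsubset) hε.le) hreal

/-- A random index is compared with a deterministic one: the sums up to `T k` and up to
`⌊q N k⌋` differ by `o(√N k)` in probability if `T k / N k → q` in probability. -/
lemma tendstoInMeasure_sum_random_sub_sum_floor {Y : ℕ → Ω → ℝ} {v : ℝ}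
    (hY : ∀ j, Measurable (Y j))
    (hL2 : ∀ j, MemLp (Y j) 2 P) (hmean : ∀ j, P[Y j] = 0) (hvar : ∀ j, Var[Y j; P] = v)
    (hindep : iIndepFun Y P) {N : ℕ → ℕ} (hN : Tendsto N atTop atTop) {T : ℕ → Ω → ℕ} {q : ℝ}
    (hq : 0 ≤ q) (hT : TendstoInMeasure P (fun k ω => (T k ω : ℝ) / N k) atTop fun _ => q) :
    TendstoInMeasure P (fun k ω => (∑ j ∈ Finset.range (T k ω), Y j ω) / √(N k)
      - (∑ j ∈ Finset.range ⌊q * N k⌋₊, Y j ω) / √(N k)) atTop 0 := by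
  have hv : 0 ≤ v := hvar 0 ▸ variance_nonneg _ _
  rw [tendstoInMeasure_iff_measureReal_norm] at hT ⊢
  intro ε hε
  simp only [Pi.zero_apply, sub_zero, Real.norm_eq_abs] at hT ⊢
  rw [Metric.tendsto_atTop]
  intro η hη
  -- The quantity made small is the bound on `P.real E` below; `3 * δ` comes from `2 * δ * N k + 1 ≤
  -- 3 * δ * N k`, valid once `1 ≤ δ * N k`.
  obtain ⟨δ, hδ, hδη⟩ : ∃ δ > 0, 2 * √(3 * δ * v) / ε < η / 2 := by
    have : Tendsto (fun δ : ℝ => 2 * √(3 * δ * v) / ε) (𝓝[>] 0) (𝓝 (2 * √(3 * 0 * v) / ε)) := by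
      refine Tendsto.mono_left (Continuous.tendsto ?_ 0) nhdsWithin_le_nhds
      fun_prop
    have h2 := this.eventually_lt_const (u := η / 2) (by simpa using hη)
    obtain ⟨δ, h3, h4⟩ := (h2.and self_mem_nhdsWithin).exists
    exact ⟨δ, h4, h3⟩
  have hNr : Tendsto (fun k => (N k : ℝ)) atTop atTop := tendsto_natCast_atTop_atTop.comp hN
  have hev := ((hT δ hδ).eventually_lt_const (half_pos hη)).and (hNr.eventually_ge_atTop (1 / δ))
  obtain ⟨K, hK⟩ := eventually_atTop.1 hev
  refine ⟨K, fun k hk => ?_⟩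
  obtain ⟨h1, h2⟩ := hK k hk
  have hNpos : 0 < (N k : ℝ) := lt_of_lt_of_le (by positivity) h2
  have h2' : 1 ≤ δ * N k := by rwa [div_le_iff₀' hδ] at h2
  have hsq : 0 < √(N k : ℝ) := Real.sqrt_pos.2 hNpos
  -- The window `[a, a + L]` contains `⌊q N k⌋`, and also `T k` when `T k / N k` is within `δ` of
  -- `q`. If `q < δ`, the natural floor gives `a = 0`, which still works.
  set a := ⌊(q - δ) * N k⌋₊ with ha
  set L := ⌊2 * δ * N k + 1⌋₊ with hL
  set m := ⌊q * N k⌋₊ with hm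
  have hindex {n : ℕ} (hl : (q - δ) * N k ≤ n + 1) (hln : a ≤ n) (hu : (n : ℝ) ≤ (q + δ) * N k) :
      ∃ i ≤ L, n = a + i := by
    refine ⟨n - a, ?_, by omega⟩
    refine Nat.le_floor ?_
    rw [Nat.cast_sub hln]
    have := Nat.lt_floor_add_one ((q - δ) * N k)
    rw [← ha] at this
    nlinarith
  -- Sums restarted at `a`: if two of them differ by at least `ε √(N k)`, one has size at least half
  -- of that.
  set E := {ω | ∃ i ≤ L, ε * √(N k) / 2 ≤ |∑ j ∈ Finset.range i, Y (a + j) ω|} with hE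
  have hPE : P.real E ≤ 2 * √(3 * δ * v) / ε := by
    have hb := mul_measureReal_exists_le_abs_sum (Y := fun j => Y (a + j)) (fun j => hY _)
      (fun j => hL2 _) (fun j => hmean _) (fun j => hvar _)
      (hindep.precomp (add_right_injective a)) L (ε := ε * √(N k) / 2) (by positivity)
    rw [← hE] at hb
    have hLle : (L : ℝ) ≤ 3 * δ * N k := by
      have := Nat.floor_le (a := 2 * δ * N k + 1) (by positivity)
      rw [← hL] at this
      linarith
    have : √(L * v) ≤ √(3 * δ * v) * √(N k) := by
      rw [← Real.sqrt_mul (by positivity)]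
      refine Real.sqrt_le_sqrt ?_
      nlinarith
    rw [le_div_iff₀ hε]
    have h3 := hb.trans this
    nlinarith
  have hsubset : {ω | ε ≤ |(∑ j ∈ Finset.range (T k ω), Y j ω) / √(N k)
      - (∑ j ∈ Finset.range m, Y j ω) / √(N k)|} ⊆ {ω | δ ≤ |(T k ω : ℝ) / N k - q|} ∪ E := by
    intro ω hω
    by_cases hδω : δ ≤ |(T k ω : ℝ) / N k - q|
    · exact Or.inl hδω
    right
    push Not at hδω
    obtain ⟨hl, hu⟩ := abs_lt.1 hδω
    have hl' : (q - δ) * N k ≤ T k ω := by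
      rw [← le_div_iff₀ hNpos]; linarith
    have hu' : (T k ω : ℝ) ≤ (q + δ) * N k := by
      rw [← div_le_iff₀ hNpos]; linarith
    have haT : a ≤ T k ω := Nat.floor_le_of_le hl'
    have ham : a ≤ m := Nat.floor_le_floor (by nlinarith)
    have hm1 : (m : ℝ) ≤ q * N k := Nat.floor_le (by positivity)
    have hm2 := Nat.lt_floor_add_one (q * N k)
    rw [← hm] at hm2
    obtain ⟨i, hi, hTi⟩ := hindex (by linarith) haT hu'
    obtain ⟨i', hi', hmi⟩ := hindex (n := m) (by nlinarith) ham (by nlinarith)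
    simp only [Set.mem_ofPred_eq] at hω
    rw [← sub_div, abs_div, abs_of_pos hsq, le_div_iff₀ hsq, hTi, hmi, Finset.sum_range_add,
      Finset.sum_range_add, add_sub_add_left_eq_sub] at hω
    by_contra hcon
    simp only [hE, Set.mem_ofPred_eq, not_exists, not_and, not_le] at hcon
    have c1 := hcon i hi
    have c2 := hcon i' hi'
    have := abs_sub (∑ x ∈ Finset.range i, Y (a + x) ω) (∑ x ∈ Finset.range i', Y (a + x) ω)
    linarith
  rw [Real.dist_0_eq_abs, abs_of_nonneg measureReal_nonneg]
  calc _ ≤ _ := measureReal_mono hsubset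
    _ ≤ _ := measureReal_union_le _ _
    _ < η / 2 + η / 2 := add_lt_add h1 (hPE.trans_lt hδη)
    _ = η := add_halves η

/-- If `D k → 0` in probability and `V k` is bounded in probability, `D k * V k → 0`
in probability. -/
lemma tendstoInMeasure_mul_of_bounded {D V : ℕ → Ω → ℝ} (hD : TendstoInMeasure P D atTop 0)
    {C : ℝ} (hV : ∀ M > 0, ∀ᶠ k in atTop, M * P.real {ω | M ≤ |V k ω|} ≤ C) :
    TendstoInMeasure P (fun k ω => D k ω * V k ω) atTop 0 := by
  rw [tendstoInMeasure_iff_measureReal_norm] at hD ⊢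
  simp only [Pi.zero_apply, sub_zero, Real.norm_eq_abs] at hD ⊢
  intro ε hε
  rw [Metric.tendsto_atTop]
  intro η hη
  -- Then `C / M < η / 2`; the `+ 1` gives strictness and `M > 0`.
  set M := 2 * (|C| + 1) / η with hMdef
  have hM : 0 < M := by positivity
  obtain ⟨K, hK⟩ := eventually_atTop.1
    (((hD (ε / M) (by positivity)).eventually_lt_const (half_pos hη)).and (hV M hM))
  refine ⟨K, fun k hk => ?_⟩
  obtain ⟨h1, h2⟩ := hK k hk
  have h3 : P.real {ω | M ≤ |V k ω|} < η / 2 := by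
    have hMη : M * (η / 2) = |C| + 1 := by rw [hMdef]; field_simp
    nlinarith [le_abs_self C]
  have hsubset : {ω | ε ≤ |D k ω * V k ω|} ⊆ {ω | ε / M ≤ |D k ω|} ∪ {ω | M ≤ |V k ω|} := by
    intro ω hω
    by_contra hcon
    simp only [Set.mem_union, Set.mem_ofPred_eq, not_or, not_le] at hcon hω
    rw [abs_mul] at hω
    have h4 : |D k ω| * |V k ω| < ε / M * M :=
      mul_lt_mul'' hcon.1 hcon.2 (abs_nonneg _) (abs_nonneg _)
    rw [div_mul_cancel₀ _ hM.ne'] at h4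
    linarith
  rw [Real.dist_0_eq_abs, abs_of_nonneg measureReal_nonneg]
  calc _ ≤ _ := measureReal_mono hsubset
    _ ≤ _ := measureReal_union_le _ _
    _ < η / 2 + η / 2 := add_lt_add h1 h3
    _ = η := add_halves η

lemma tendstoInMeasure_add_zero {F G : ℕ → Ω → ℝ} (hF : TendstoInMeasure P F atTop 0)
    (hG : TendstoInMeasure P G atTop 0) :
    TendstoInMeasure P (fun k ω => F k ω + G k ω) atTop 0 := by
  rw [tendstoInMeasure_iff_measureReal_norm] at hF hG ⊢
  simp only [Pi.zero_apply, sub_zero, Real.norm_eq_abs] at hF hG ⊢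
  intro ε hε
  have hlim := (hF (ε / 2) (half_pos hε)).add (hG (ε / 2) (half_pos hε))
  rw [add_zero] at hlim
  refine squeeze_zero (fun _ => measureReal_nonneg) (fun k => ?_) hlim
  refine le_trans (measureReal_mono (fun ω hω => ?_)) (measureReal_union_le _ _)
  by_contra hcon
  simp only [Set.mem_union, Set.mem_ofPred_eq, not_or, not_le] at hcon hω
  linarith [abs_add_le (F k ω) (G k ω)]

lemma tendstoInMeasure_sum_zero {ι : Type*} (s : Finset ι) {F : ι → ℕ → Ω → ℝ}
    (hF : ∀ i ∈ s, TendstoInMeasure P (F i) atTop 0) :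
    TendstoInMeasure P (fun k ω => ∑ i ∈ s, F i k ω) atTop 0 := by
  classical
  induction s using Finset.induction_on with
  | empty =>
    simp only [Finset.sum_empty]
    intro ε hε
    simp [hε.ne']
  | insert i s hi ih =>
    simp_rw [Finset.sum_insert hi]
    exact tendstoInMeasure_add_zero (hF i (Finset.mem_insert_self _ _))
      (ih fun j hj => hF j (Finset.mem_insert_of_mem hj))

/-- The sums up to a random index bounded by `n` are bounded in probability on the scale `√n`. -/
lemma mul_measureReal_le_abs_sum_random_div_sqrt {Y : ℕ → Ω → ℝ} {v : ℝ}
    (hY : ∀ j, Measurable (Y j))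
    (hL2 : ∀ j, MemLp (Y j) 2 P) (hmean : ∀ j, P[Y j] = 0) (hvar : ∀ j, Var[Y j; P] = v)
    (hindep : iIndepFun Y P) {n : ℕ} (hn : 0 < n) {T : Ω → ℕ} (hT : ∀ ω, T ω ≤ n) {M : ℝ}
    (hM : 0 < M) :
    M * P.real {ω | M ≤ |(∑ j ∈ Finset.range (T ω), Y j ω) / √n|} ≤ √v := by
  have hsq : 0 < √(n : ℝ) := Real.sqrt_pos.2 (by exact_mod_cast hn)
  have h := mul_measureReal_exists_le_abs_sum hY hL2 hmean hvar hindep n (ε := M * √n)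
    (by positivity)
  have hsubset : {ω | M ≤ |(∑ j ∈ Finset.range (T ω), Y j ω) / √n|} ⊆
      {ω | ∃ m ≤ n, M * √n ≤ |∑ j ∈ Finset.range m, Y j ω|} := by
    intro ω hω
    simp only [Set.mem_ofPred_eq] at hω
    rw [abs_div, abs_of_pos hsq, le_div_iff₀ hsq] at hω
    exact ⟨T ω, hT ω, hω⟩
  have h2 := measureReal_mono (μ := P) hsubset
  rw [Real.sqrt_mul (Nat.cast_nonneg n)] at h
  refine le_of_mul_le_mul_left ?_ hsq
  calc √n * (M * P.real {ω | M ≤ |(∑ j ∈ Finset.range (T ω), Y j ω) / √n|})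
      ≤ √n * (M * P.real {ω | ∃ m ≤ n, M * √n ≤ |∑ j ∈ Finset.range m, Y j ω|}) := by gcongr
    _ ≤ _ := by linarith

end Sums

/-! ### Central limit theorem, deterministic then random sample sizes -/

section CentralLimit

variable {Ω : Type*} [MeasurableSpace Ω] {P : Measure Ω}

/-- Both sides expand into the same product over single variables `Y i j`; flattening the double sum
over a sigma type lets joint independence be used directly. -/
lemma charFun_sum_mul_sum_range {I : ℕ} {Y : Fin I → ℕ → Ω → ℝ} (hY : ∀ i j, Measurable (Y i j))
    (hindep : iIndepFun (fun ij : Fin I × ℕ => Y ij.1 ij.2) P) (b : Fin I → ℝ) (r : ℝ)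
    (n : Fin I → ℕ) (t : ℝ) :
    charFun (P.map fun ω => ∑ i, b i * (r * ∑ j ∈ Finset.range (n i), Y i j ω)) t =
      ∏ i, charFun (P.map fun ω => r * ∑ j ∈ Finset.range (n i), Y i j ω) (b i * t) := by
  have hinj : Function.Injective (fun x : (_ : Fin I) × ℕ => (x.1, x.2)) := by
    rintro ⟨i, j⟩ ⟨i', j'⟩ h
    simp only [Prod.mk.injEq] at h
    obtain ⟨rfl, rfl⟩ := h
    rfl
  have hindepσ : iIndepFun (fun (x : (_ : Fin I) × ℕ) ω => b x.1 * r * Y x.1 x.2 ω) P :=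
    (hindep.precomp hinj).comp (fun x y => b x.1 * r * y) (fun x => by fun_prop)
  have hrow (i : Fin I) : iIndepFun (Y i) P :=
    hindep.precomp (g := fun j => (i, j)) fun j j' h => (Prod.mk.inj h).2
  have hrow' (i : Fin I) : charFun (P.map fun ω => r * ∑ j ∈ Finset.range (n i), Y i j ω) (b i * t)
      = ∏ j ∈ Finset.range (n i), charFun (P.map (Y i j)) (b i * r * t) := by
    rw [charFun_map_mul_comp (by fun_prop),
      ((hrow i).restrict _).charFun_map_fun_finsetSum_eq_prod fun j _ => (hY i j).aemeasurable,
      Finset.prod_apply]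
    simp [mul_comm, mul_left_comm]
  have hsum : (fun ω => ∑ i, b i * (r * ∑ j ∈ Finset.range (n i), Y i j ω)) =
      fun ω => ∑ x ∈ Finset.univ.sigma fun i => Finset.range (n i), b x.1 * r * Y x.1 x.2 ω := by
    ext ω
    simp [Finset.sum_sigma, Finset.mul_sum, mul_assoc]
  rw [hsum, (hindepσ.restrict _).charFun_map_fun_finsetSum_eq_prod
    fun x _ => ((hY x.1 x.2).const_mul _).aemeasurable, Finset.prod_apply, Finset.prod_sigma]
  refine Finset.prod_congr rfl fun i _ => ?_
  rw [hrow']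
  refine Finset.prod_congr rfl fun j _ => ?_
  rw [charFun_map_mul_comp (hY i j).aemeasurable]

variable [IsProbabilityMeasure P]

/-- The central limit theorem along `⌊q N k⌋` terms with the normalization `√(N k)`. -/
lemma tendsto_charFun_sum_floor {Y : ℕ → Ω → ℝ}
    (hL2 : MemLp (Y 0) 2 P) (hmean : P[Y 0] = 0)
    (hindep : iIndepFun Y P) (hident : ∀ j, IdentDistrib (Y j) (Y 0) P P)
    {N : ℕ → ℕ} (hN : Tendsto N atTop atTop) {q : ℝ} (hq : 0 ≤ q) (t : ℝ) :
    Tendsto (fun k => charFun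
      (P.map fun ω => (√(N k))⁻¹ * ∑ j ∈ Finset.range ⌊q * N k⌋₊, Y j ω) t) atTop
      (𝓝 (Complex.exp (-(Var[Y 0; P] * q * t ^ 2 / 2 : ℝ)))) := by
  -- For `q = 0` the number of terms does not tend to infinity, but all sums are empty and both
  -- sides equal `1`.
  rcases hq.eq_or_lt with rfl | hq
  · simp
  have hNr : Tendsto (fun k => (N k : ℝ)) atTop atTop := tendsto_natCast_atTop_atTop.comp hN
  have hn : Tendsto (fun k => ⌊q * N k⌋₊) atTop atTop :=
    tendsto_nat_floor_atTop.comp (hNr.const_mul_atTop hq)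
  have hratio : Tendsto (fun k => √(⌊q * N k⌋₊ : ℝ) / √(N k)) atTop (𝓝 √q) := by
    have h := (Real.continuous_sqrt.tendsto q).comp
      ((tendsto_nat_floor_mul_div_atTop hq.le).comp hNr)
    refine h.congr fun k => ?_
    simp [Real.sqrt_div]
  have hclt := tendstoInDistribution_inv_sqrt_mul_sum_sub (Y := id)
    (P' := gaussianReal 0 Var[Y 0; P].toNNReal) ⟨aemeasurable_id, by simp⟩ hL2 hindep hident
  have hsub : TendstoInDistribution (fun (k : ℕ) ω => (√(⌊q * N k⌋₊ : ℝ))⁻¹ *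
      (∑ j ∈ Finset.range ⌊q * N k⌋₊, Y j ω - (⌊q * N k⌋₊ : ℝ) * P[Y 0])) atTop id (fun _ => P)
      (gaussianReal 0 Var[Y 0; P].toNNReal) :=
    ⟨fun k => hclt.forall_aemeasurable _, hclt.aemeasurable_limit, hclt.tendsto.comp hn⟩
  -- Slutsky: the factor `√⌊q N k⌋ / √(N k) → √q` changes the normalization.
  have hmul := hsub.continuous_comp_prodMk_of_tendstoInMeasure_const
    (g := fun x : ℝ × ℝ => x.2 * x.1) (by fun_prop)
    (Y := fun k _ => √(⌊q * N k⌋₊ : ℝ) / √(N k)) (c := √q)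
    (tendstoInMeasure_of_tendsto_ae (fun _ => aestronglyMeasurable_const)
      (ae_of_all _ fun _ => hratio)) (fun _ => aemeasurable_const)
  have hchar := ProbabilityMeasure.tendsto_iff_tendsto_charFun.1 hmul.tendsto t
  simp only [ProbabilityMeasure.coe_mk, id_eq, hmean, mul_zero, sub_zero] at hchar
  have hlim : charFun ((gaussianReal 0 Var[Y 0; P].toNNReal).map fun x => √q * x) t =
      Complex.exp (-(Var[Y 0; P] * q * t ^ 2 / 2 : ℝ)) := by
    rw [charFun_map_mul, charFun_gaussianReal]
    congr 1
    have h1 : ((Var[Y 0; P].toNNReal : ℝ) : ℂ) = (Var[Y 0; P] : ℂ) := by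
      rw [Real.coe_toNNReal _ (variance_nonneg _ _)]
    rw [h1]
    have h2 : ((√q : ℝ) : ℂ) ^ 2 = q := by
      rw [← Complex.ofReal_pow, Real.sq_sqrt hq.le]
    push_cast
    rw [mul_pow, h2]
    ring
  rw [hlim] at hchar
  refine hchar.congr' ?_
  filter_upwards [hn.eventually_gt_atTop 0] with k hk
  congr 2
  ext ω
  have : √(⌊q * N k⌋₊ : ℝ) ≠ 0 := (Real.sqrt_pos.2 (by exact_mod_cast hk)).ne'
  field_simp

/-- The central limit theorem for independent strata with deterministic sample sizes. -/
lemma tendstoInDistribution_sum_strata_floor {I : ℕ} {Y : Fin I → ℕ → Ω → ℝ}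
    (hY : ∀ i j, Measurable (Y i j)) (hL2 : ∀ i, MemLp (Y i 0) 2 P) (hmean : ∀ i, P[Y i 0] = 0)
    (hindep : iIndepFun (fun ij : Fin I × ℕ => Y ij.1 ij.2) P)
    (hident : ∀ i j, IdentDistrib (Y i j) (Y i 0) P P)
    {N : ℕ → ℕ} (hN : Tendsto N atTop atTop) {q : Fin I → ℝ} (hq : ∀ i, 0 ≤ q i)
    (b : Fin I → ℝ) :
    TendstoInDistribution (fun k ω => ∑ i, b i * ((√(N k))⁻¹ *
        ∑ j ∈ Finset.range ⌊q i * N k⌋₊, Y i j ω)) atTop (id : ℝ → ℝ) (fun _ => P)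
      (gaussianReal 0 (∑ i, b i ^ 2 * Var[Y i 0; P] * q i).toNNReal) where
  forall_aemeasurable k := by fun_prop
  tendsto := by
    refine ProbabilityMeasure.tendsto_iff_tendsto_charFun.2 fun t => ?_
    have hrow (i : Fin I) : iIndepFun (Y i) P :=
      hindep.precomp (g := fun j => (i, j)) fun j j' h => (Prod.mk.inj h).2
    have hlim := tendsto_finsetProd Finset.univ fun i _ =>
      tendsto_charFun_sum_floor (hL2 i) (hmean i) (hrow i) (hident i) hN (hq i) (b i * t)
    have hnonneg : 0 ≤ ∑ i, b i ^ 2 * Var[Y i 0; P] * q i :=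
      Finset.sum_nonneg fun i _ =>
        mul_nonneg (mul_nonneg (sq_nonneg _) (variance_nonneg _ _)) (hq i)
    simp only [ProbabilityMeasure.coe_mk, charFun_sum_mul_sum_range hY hindep, Measure.map_id]
    convert! hlim using 2
    rw [charFun_gaussianReal, ← Complex.exp_sum, Real.coe_toNNReal _ hnonneg]
    congr 1
    push_cast
    rw [Finset.sum_mul, Finset.sum_div, Finset.sum_neg_distrib]
    simp only [mul_zero, zero_mul, zero_sub]
    congr 1
    exact Finset.sum_congr rfl fun i _ => by ring

/-- A sum up to a random index is measurable. -/
lemma measurable_sum_range_random {Y : ℕ → Ω → ℝ} (hY : ∀ j, Measurable (Y j)) {T : Ω → ℕ}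
    (hT : Measurable T) : Measurable fun ω => ∑ j ∈ Finset.range (T ω), Y j ω := by
  have h : Measurable fun x : ℕ × Ω => ∑ j ∈ Finset.range x.1, Y j x.2 :=
    measurable_from_prod_countable_right fun n => by
      simp only
      fun_prop
  exact h.comp (hT.prodMk measurable_id)

/-- The central limit theorem for independent strata with random sample sizes `T k i` such that
the proportions `T k i / N k` converge to the optimal ones. -/
lemma tendstoInDistribution_stratified {I : ℕ} {Y : Fin I → ℕ → Ω → ℝ}
    (hY : ∀ i j, Measurable (Y i j)) (hL2 : ∀ i, MemLp (Y i 0) 2 P) (hmean : ∀ i, P[Y i 0] = 0)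
    (hindep : iIndepFun (fun ij : Fin I × ℕ => Y ij.1 ij.2) P)
    (hident : ∀ i j, IdentDistrib (Y i j) (Y i 0) P P)
    {p s : Fin I → ℝ} (hp : ∀ i, 0 < p i) (hs : ∀ i, 0 ≤ s i)
    (hvar : ∀ i, Var[Y i 0; P] = s i ^ 2) (hpos : 0 < ∑ i, p i * s i)
    {N : ℕ → ℕ} (hN : Tendsto N atTop atTop) {T : ℕ → Fin I → Ω → ℕ}
    (hT : ∀ k i, Measurable (T k i)) (hTN : ∀ k i ω, T k i ω ≤ N k)
    (hq : ∀ i, ∀ᵐ ω ∂P, Tendsto (fun k => (T k i ω : ℝ) / (N k : ℝ)) atTop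
      (𝓝 (p i * s i / ∑ j, p j * s j))) :
    TendstoInDistribution
      (fun k ω => √(N k) * ∑ i, p i / (T k i ω : ℝ) * ∑ j ∈ Finset.range (T k i ω), Y i j ω)
      atTop (id : ℝ → ℝ) (fun _ => P) (gaussianReal 0 ((∑ i, p i * s i) ^ 2).toNNReal) := by
  set S := ∑ i, p i * s i with hS
  set q : Fin I → ℝ := fun i => p i * s i / S with hqdef
  have hq0 (i : Fin I) : 0 ≤ q i := div_nonneg (mul_nonneg (hp i).le (hs i)) hpos.le
  -- This is `p i / q i` when `s i > 0`; when `s i = 0` division by zero makes it `0`.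
  set b : Fin I → ℝ := fun i => S / s i with hb
  have hclt := tendstoInDistribution_sum_strata_floor hY hL2 hmean hindep hident hN hq0 b
  have hvarsum : ∑ i, b i ^ 2 * Var[Y i 0; P] * q i = S ^ 2 := by
    have (i : Fin I) : b i ^ 2 * Var[Y i 0; P] * q i = S * (p i * s i) := by
      rw [hvar, hb, hqdef]
      rcases eq_or_ne (s i) 0 with h | h
      · simp [h]
      · field_simp
    rw [Finset.sum_congr rfl fun i _ => this i, ← Finset.mul_sum, ← hS, sq]
  rw [hvarsum] at hclt
  have hTr (k : ℕ) (i : Fin I) : Measurable fun ω => (T k i ω : ℝ) :=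
    measurable_from_nat.comp (hT k i)
  have hsummeas (k : ℕ) (i : Fin I) :
      Measurable fun ω => ∑ j ∈ Finset.range (T k i ω), Y i j ω :=
    measurable_sum_range_random (hY i) (hT k i)
  refine tendstoInDistribution_of_tendstoInMeasure_sub _ _ hclt ?_ fun k => by fun_prop
  have hterm (i : Fin I) : TendstoInMeasure P (fun k ω =>
      √(N k) * (p i / (T k i ω : ℝ) * ∑ j ∈ Finset.range (T k i ω), Y i j ω) -
      b i * ((√(N k))⁻¹ * ∑ j ∈ Finset.range ⌊q i * N k⌋₊, Y i j ω)) atTop 0 := by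
    have hL2' (j : ℕ) : MemLp (Y i j) 2 P := (hident i j).memLp_iff.2 (hL2 i)
    have hmean' (j : ℕ) : P[Y i j] = 0 := (hident i j).integral_eq.trans (hmean i)
    have hvar' (j : ℕ) : Var[Y i j; P] = s i ^ 2 := (hident i j).variance_eq.trans (hvar i)
    have hrow : iIndepFun (Y i) P :=
      hindep.precomp (g := fun j => (i, j)) fun j j' h => (Prod.mk.inj h).2
    -- If `s i = 0` then `T k i / N k → 0` and the ratio argument fails, but the `Y i j` vanish
    -- almost surely.
    rcases (hs i).eq_or_lt with h0 | hsi
    · have hzero : ∀ᵐ ω ∂P, ∀ j, Y i j ω = 0 := by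
        refine ae_all_iff.2 fun j => ?_
        filter_upwards [ae_eq_integral_of_variance_eq_zero (hL2' j)
          (by rw [hvar', ← h0]; simp)] with ω hω
        rw [hω, hmean']
      have hcongr (k : ℕ) : (fun _ => 0) =ᵐ[P] fun ω =>
          √(N k) * (p i / (T k i ω : ℝ) * ∑ j ∈ Finset.range (T k i ω), Y i j ω) -
          b i * ((√(N k))⁻¹ * ∑ j ∈ Finset.range ⌊q i * N k⌋₊, Y i j ω) := by
        filter_upwards [hzero] with ω hω
        simp [hω]
      refine TendstoInMeasure.congr_left hcongr fun ε hε => ?_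
      simp [hε.ne']
    · have hqi : 0 < q i := div_pos (mul_pos (hp i) hsi) hpos
      -- With `S_T`, `S_q` the sums up to `T k i` and `⌊q i * N k⌋`, the difference is `(p i N / T -
      -- b i) S_T / √N + b i (S_T - S_q) / √N`: vanishing times bounded in probability, plus the
      -- Anscombe error.
      have hratio : TendstoInMeasure P (fun k ω => p i * N k / T k i ω - b i) atTop 0 := by
        refine tendstoInMeasure_of_tendsto_ae (fun k => ?_) ?_
        · exact Measurable.aestronglyMeasurable (by fun_prop)
        · filter_upwards [hq i] with ω hω
          have h1 := ((hω.inv₀ hqi.ne').const_mul (p i)).sub_const (b i)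
          have h2 : p i * (q i)⁻¹ - b i = 0 := by
            have := (hp i).ne'
            have := hpos.ne'
            simp only [hqdef, hb]
            field_simp
            simp
          change Tendsto _ _ (𝓝 (p i * (q i)⁻¹ - b i)) at h1
          rw [h2] at h1
          refine h1.congr fun k => ?_
          rw [inv_div, mul_div_assoc]
      have hTq : TendstoInMeasure P (fun k ω => (T k i ω : ℝ) / N k) atTop fun _ => q i :=
        tendstoInMeasure_of_tendsto_ae
          (fun k => Measurable.aestronglyMeasurable (by fun_prop)) (hq i)
      have hdiff := tendstoInMeasure_sum_random_sub_sum_floor (hY i) hL2' hmean' hvar' hrow hN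
        (hq0 i) hTq
      have hfirst := tendstoInMeasure_mul_of_bounded hratio
        (V := fun k ω => (∑ j ∈ Finset.range (T k i ω), Y i j ω) / √(N k)) (C := √(s i ^ 2))
        fun M hM => by
          filter_upwards [hN.eventually_gt_atTop 0] with k hk
          exact mul_measureReal_le_abs_sum_random_div_sqrt (hY i) hL2' hmean' hvar' hrow hk
            (hTN k i) hM
      have hsecond := tendstoInMeasure_mul_of_bounded hdiff (V := fun _ _ => b i) (C := |b i|)
        fun M hM => by
          refine Eventually.of_forall fun k => ?_
          by_cases hMb : M ≤ |b i| <;> simp [hMb]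
      refine (tendstoInMeasure_add_zero hfirst hsecond).congr_left fun k => ae_of_all _ fun ω => ?_
      dsimp only
      have hsq : √(N k : ℝ) = N k / √(N k) := Real.div_sqrt.symm
      nth_rewrite 4 [hsq]
      ring
  refine (tendstoInMeasure_sum_zero Finset.univ fun i _ => hterm i).congr_left fun k =>
    ae_of_all _ fun ω => ?_
  simp only [Pi.sub_apply, Finset.sum_sub_distrib, Finset.mul_sum]

end CentralLimit

/-! ### Conditional laws on the strata -/

section Strata

variable {Ω₀ : Type*} [MeasurableSpace Ω₀] {P₀ : Measure Ω₀} {d I : ℕ}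
  {X : Ω₀ → EuclideanSpace ℝ (Fin d)} {f : EuclideanSpace ℝ (Fin d) → ℝ}
  {A : Fin I → Set (EuclideanSpace ℝ (Fin d))}

lemma measure_preimage_ne_zero {i : Fin I} (hp : 0 < prob P₀ X A i) : P₀ (X ⁻¹' A i) ≠ 0 :=
  fun h => hp.ne' (by simp [prob, measureReal_def, h])

lemma memLp_condLaw (hX : Measurable X) (hf : Measurable f) {i : Fin I}
    (hp : 0 < prob P₀ X A i) (h : MemLp (fun ω => f (X ω)) 2 P₀) :
    MemLp f 2 (condLaw P₀ X A i) := by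
  refine (memLp_map_measure_iff hf.aestronglyMeasurable hX.aemeasurable).2 ?_
  exact (h.restrict _).smul_measure (ENNReal.inv_ne_top.2 (measure_preimage_ne_zero hp))

/-- The total expectation is the average of the conditional expectations given the strata. -/
lemma sum_prob_mul_integral_condLaw (hX : Measurable X) (hf : Measurable f)
    (hA : ∀ i, MeasurableSet (A i)) (hA_disj : Pairwise fun i j => Disjoint (A i) (A j))
    (hA_univ : ⋃ i, A i = Set.univ) (hp : ∀ i, 0 < prob P₀ X A i)
    (hint : Integrable (fun ω => f (X ω)) P₀) :
    ∑ i, prob P₀ X A i * ∫ x, f x ∂(condLaw P₀ X A i) = ∫ ω, f (X ω) ∂P₀ := by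
  have hterm (i : Fin I) : prob P₀ X A i * ∫ x, f x ∂(condLaw P₀ X A i) =
      ∫ ω in X ⁻¹' A i, f (X ω) ∂P₀ := by
    rw [condLaw, integral_map hX.aemeasurable hf.aestronglyMeasurable, ProbabilityTheory.cond,
      integral_smul_measure, ENNReal.toReal_inv, smul_eq_mul, ← measureReal_def]
    exact mul_inv_cancel_left₀ (hp i).ne' _
  rw [Finset.sum_congr rfl fun i _ => hterm i, ← integral_iUnion_fintype (fun i => hX (hA i))
    (fun i j hij => (hA_disj hij).preimage X) fun i => hint.integrableOn,
    ← Set.preimage_iUnion, hA_univ, Set.preimage_univ, setIntegral_univ]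

end Strata

/-! ### Growth and measurability of the allocation -/

section Allocation

variable {Ω : Type*} {d I : ℕ}
  {Xs : Fin I → ℕ → Ω → EuclideanSpace ℝ (Fin d)} {N : ℕ → ℕ}
  {Ns : ℕ → Fin I → Ω → ℕ}

lemma IsAdaptiveAllocation.le_total (hN : IsAdaptiveAllocation Xs N Ns) (k : ℕ) (i : Fin I)
    (ω : Ω) : Ns k i ω ≤ N k :=
  hN.sum_eq k ω ▸ Finset.single_le_sum (f := fun i => Ns k i ω) (fun _ _ => Nat.zero_le _)
    (Finset.mem_univ i)

lemma IsAdaptiveAllocation.tendsto_total (hN : IsAdaptiveAllocation Xs N Ns) (hI : 0 < I) :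
    Tendsto N atTop atTop :=
  (strictMono_nat_of_lt_succ fun k => by have := hN.total_step k; omega).tendsto_atTop

variable [MeasurableSpace Ω]

lemma drawInfo_le (hXs : ∀ i j, Measurable (Xs i j)) {n : Fin I → Ω → ℕ}
    (hn : ∀ i, Measurable (n i)) : drawInfo Xs n ≤ (inferInstance : MeasurableSpace Ω) := by
  refine iSup_le fun i => iSup_le fun j => Measurable.comap_le ?_
  exact Measurable.ite (measurableSet_lt measurable_const (hn i)) (hXs i j) measurable_const

/-- Induction on the step: once the sizes at step `k` are measurable, `drawInfo Xs (Ns k)` lies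
inside the ambient sigma-algebra. -/
lemma IsAdaptiveAllocation.measurable (hN : IsAdaptiveAllocation Xs N Ns)
    (hXs : ∀ i j, Measurable (Xs i j)) (k : ℕ) (i : Fin I) : Measurable (Ns k i) := by
  induction k generalizing i with
  | zero =>
    rw [funext (hN.zero i)]
    exact measurable_const
  | succ k ih => exact (hN.nonanticipating k i).mono (drawInfo_le hXs ih) le_rfl

end Allocation

end Stratified

/-! ### Reduction to the centred array -/

theorem mainTheorem2 {Ω₀ Ω : Type*} [MeasurableSpace Ω₀] [MeasurableSpace Ω]
    (P₀ : Measure Ω₀) [IsProbabilityMeasure P₀] (P : Measure Ω) [IsProbabilityMeasure P]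
    {d I : ℕ}
    -- the random variable `X`, the integrand `f` and the strata `A_i`
    (X : Ω₀ → EuclideanSpace ℝ (Fin d)) (hX : Measurable X)
    (f : EuclideanSpace ℝ (Fin d) → ℝ) (hf : Measurable f)
    (A : Fin I → Set (EuclideanSpace ℝ (Fin d)))
    (hA : ∀ i, MeasurableSet (A i))
    (hA_disj : Pairwise fun i j => Disjoint (A i) (A j))
    (hA_univ : ⋃ i, A i = Set.univ)
    (hp : ∀ i, 0 < Stratified.prob P₀ X A i)
    (hσ : ∃ i, 0 < Stratified.sd P₀ X A f i)
    -- the drawings: independent, those of stratum `i` with the law of `X` given `X ∈ A_i`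
    (Xs : Fin I → ℕ → Ω → EuclideanSpace ℝ (Fin d))
    (hXs : ∀ i j, Measurable (Xs i j))
    (hXs_law : ∀ i j, P.map (Xs i j) = Stratified.condLaw P₀ X A i)
    (hXs_indep : iIndepFun (fun (ij : Fin I × ℕ) => Xs ij.1 ij.2) P)
    -- the adaptive allocation
    (N : ℕ → ℕ) (Ns : ℕ → Fin I → Ω → ℕ)
    (hN : Stratified.IsAdaptiveAllocation Xs N Ns)
    -- square integrability, and convergence to the optimal proportions
    (hf2 : Integrable (fun ω => f (X ω) ^ 2) P₀)
    (hq : ∀ i, ∀ᵐ ω ∂P, Tendsto (fun k => (Ns k i ω : ℝ) / (N k : ℝ)) atTop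
      (𝓝 (Stratified.qStar P₀ X A f i))) :
    TendstoInDistribution
      (fun (k : ℕ) (ω : Ω) => √(N k : ℝ) *
        (Stratified.estimator (Stratified.prob P₀ X A) f Xs (Ns k) ω - ∫ ω', f (X ω') ∂P₀))
      atTop (id : ℝ → ℝ) (fun _ => P)
      (gaussianReal 0 (Stratified.sdStar P₀ X A f ^ 2).toNNReal) := by
  have hIpos : 0 < I := hσ.elim fun i _ => i.pos
  have hpos : 0 < ∑ i, Stratified.prob P₀ X A i * Stratified.sd P₀ X A f i := by
    obtain ⟨i, hi⟩ := hσ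
    exact Finset.sum_pos' (fun j _ => mul_nonneg (hp j).le (Real.sqrt_nonneg _))
      ⟨i, Finset.mem_univ i, mul_pos (hp i) hi⟩
  have hmemX : MemLp (fun ω => f (X ω)) 2 P₀ :=
    (memLp_two_iff_integrable_sq (hf.comp hX).aestronglyMeasurable).2 hf2
  have hmem (i : Fin I) : MemLp f 2 (Stratified.condLaw P₀ X A i) :=
    Stratified.memLp_condLaw hX hf (hp i) hmemX
  set m : Fin I → ℝ := fun i => ∫ x, f x ∂(Stratified.condLaw P₀ X A i) with hm
  set Y : Fin I → ℕ → Ω → ℝ := fun i j ω => f (Xs i j ω) - m i with hYdef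
  have hY (i : Fin I) (j : ℕ) : Measurable (Y i j) := (hf.comp (hXs i j)).sub_const _
  have hmemXs (i : Fin I) : MemLp (fun ω => f (Xs i 0 ω)) 2 P := by
    have h := hmem i
    rw [← hXs_law i 0] at h
    exact h.comp_of_map (hXs i 0).aemeasurable
  have hL2 (i : Fin I) : MemLp (Y i 0) 2 P := (hmemXs i).sub (memLp_const _)
  have hmeanXs (i : Fin I) : ∫ ω, f (Xs i 0 ω) ∂P = m i := by
    simp only [hm]
    rw [← hXs_law i 0, integral_map (hXs i 0).aemeasurable hf.aestronglyMeasurable]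
  have hmean (i : Fin I) : P[Y i 0] = 0 := by
    rw [hYdef, integral_sub ((hmemXs i).integrable one_le_two) (integrable_const _), hmeanXs]
    simp
  have hvar (i : Fin I) : Var[Y i 0; P] = Stratified.sd P₀ X A f i ^ 2 := by
    rw [Stratified.sd, Real.sq_sqrt (variance_nonneg _ _), ← hXs_law i 0,
      variance_map hf.aemeasurable (hXs i 0).aemeasurable, hYdef,
      variance_sub_const (hmemXs i).aestronglyMeasurable]
    rfl
  have hindep : iIndepFun (fun ij : Fin I × ℕ => Y ij.1 ij.2) P :=
    hXs_indep.comp (fun ij x => f x - m ij.1) fun ij => hf.sub_const _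
  have hident (i : Fin I) (j : ℕ) : IdentDistrib (Y i j) (Y i 0) P P := by
    have h : IdentDistrib (Xs i j) (Xs i 0) P P :=
      ⟨(hXs i j).aemeasurable, (hXs i 0).aemeasurable, by rw [hXs_law, hXs_law]⟩
    exact h.comp (hf.sub_const (m i))
  have hmain := Stratified.tendstoInDistribution_stratified hY hL2 hmean hindep hident hp
    (fun i => Real.sqrt_nonneg _) hvar hpos (hN.tendsto_total hIpos)
    (hN.measurable hXs) hN.le_total hq
  refine hmain.congr (fun k => ae_of_all _ fun ω => ?_) (EventuallyEq.refl _ _)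
  -- At `k = 0` the sample sizes are zero, but `√(N 0) = 0` kills both sides; later sizes are
  -- positive, so centring commutes with averaging.
  rcases k with _ | k
  · simp [hN.total_zero]
  have hc := Stratified.sum_prob_mul_integral_condLaw hX hf hA hA_disj hA_univ hp
    (hmemX.integrable one_le_two)
  dsimp only
  rw [← hc, Stratified.estimator, ← Finset.sum_sub_distrib]
  congr 1
  refine Finset.sum_congr rfl fun i _ => ?_
  have hne : (Ns (k + 1) i ω : ℝ) ≠ 0 := by
    have := hN.step k i ω
    exact_mod_cast (by omega : Ns (k + 1) i ω ≠ 0)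
  simp only [hYdef, hm, Finset.sum_sub_distrib, Finset.sum_const, Finset.card_range, nsmul_eq_mul]
  field_simp
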